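/- A directed graph $E=(E^0,E^1,r_E,s_E)$ has vertex set $E^0$, edge set $E^1$ and range and source maps $r_E,s_E:E^1\to E^0$; graph morphisms are pairs of maps on vertices and edges commuting with range and source. A textile system $T=(E,F,p,q)$ consists of directed graphs $E,F$ and graph morphisms $p,q:F\to E$ such that $f\mapsto(p(f),q(f),r_F(f),s_F(f))$ is injective on $F^1$. The morphism $p$ has unique $r$-path lifting if for all $e\in E^1$, $w\in F^0$ with $r_E(e)=p(w)$ there is a unique $f\in F^1$ with $r_F(f)=w$ and $p(f)=e$; unique $s$-path lifting is defined in the same way with $s$ in place of $r$. A $2$-coloured graph is a directed graph with a map from its edges to $\{c_1,c_2\}$; coloured-graph morphisms are graph morphisms that preserve colours. A square in a $2$-coloured graph $G$ is a coloured-graph morphism $\phi:E_{2,e_1+e_2}\to G$, where $E_{2,e_1+e_2}$ has vertices $\{n\in\mathbb N^2: n\le e_1+e_2\}$ and, whenever $n+e_i\le e_1+e_2$, one edge $\varepsilon_i^n$ of colour $c_i$ with range $n$ and source $n+e_i$. If $\mathcal C_G$, $\mathcal C_H$ are collections of squares in $2$-coloured graphs $G$, $H$, then $(G,\mathcal C_G)\cong(H,\mathcal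 C_H)$ (square-isomorphic) means that there is a coloured-graph isomorphism $\phi:G\to H$ with $\{\phi\circ\psi:\psi\in\mathcal C_G\}=\mathcal C_H$. For a textile system $T$, the $2$-coloured graph $G_T$ has vertex set $E^0$ and edge set $E^1\sqcup F^0$, where $e\in E^1$ has range $r_E(e)$, source $s_E(e)$ and colour $c_1$, and $w\in F^0$ has range $q(w)$, source $p(w)$ and colour $c_2$. Put $\mathcal C_T=\{\phi_f:f\in F^1\}$, where $\phi_f$ is the square in $G_T$ with $\phi_f(\varepsilon_1^0)=q(f)$, $\phi_f(\varepsilon_1^{e_2})=p(f)$, $\phi_f(\varepsilon_2^0)=r_F(f)$, $\phi_f(\varepsilon_2^{e_1})=s_F(f)$. A $2$-graph is a countable category $\Lambda$ with a degree functor $d:\Lambda\to\mathbb N^2$ such that whenever $d(\lambda)=m+n$ there are unique $\mu,\nu\in\Lambda$ with $d(\mu)=m$, $d(\nu)=n$ and $\lambda=\mu\nu$. For $m\le n\le d(\lambda)$, $\lambda(m,n)$ denotes the middle factor of degree $n-m$ in $\lambda=\lambda'\,\lambda(m,n)\,\lambda''$ with $d(\lambda')=m$, $d(\lambda'')=d(\lambda)-n$.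 Its $1$-skeleton $\mathrm{Sk}_\Lambda$ is the $2$-coloured graph whose vertices are the objects of $\Lambda$ and whose edges of colour $c_i$ are the morphisms of degree $e_i$; its canonical collection of squares is $\mathcal C_\Lambda=\{\phi_\lambda:d(\lambda)=e_1+e_2\}$ with $\phi_\lambda(\varepsilon_l^n)=\lambda(n,n+e_l)$. Isomorphisms of $2$-graphs are isomorphisms of categories that preserve degree. **Theorem.** Let $T=(E,F,p,q)$ be a textile system. 1. Suppose that $E^0$, $E^1$ and $F^0$ are countable. If $p$ has unique $r$-path lifting and $q$ has unique $s$-path lifting, then there is a $2$-graph $\Lambda_T$, unique up to isomorphism, with $(\mathrm{Sk}_{\Lambda_T},\mathcal C_{\Lambda_T})\cong(G_T,\mathcal C_T)$. 2. Conversely, if $\Lambda$ is a $2$-graph with $(\mathrm{Sk}_\Lambda,\mathcal C_\Lambda)\cong(G_T,\mathcal C_T)$, then $p$ has unique $r$-path lifting, $q$ has unique $s$-path lifting, and $\Lambda\cong\Lambda_T$; that is, $\Lambda$ is isomorphic to every $2$-graph $\Lambda'$ with $(\mathrm{Sk}_{\Lambda'},\mathcal C_{\Lambda'})\cong(G_T,\mathcal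 C_T)$. -/

import Mathlib

open CategoryTheory

set_option linter.checkUnivs false

universe u v w

/-! ### Directed graphs -/

/-- A directed graph `(E⁰, E¹, r, s)`. -/
structure DirGraph : Type (max (u + 1) (v + 1)) where
  /-- vertices -/
  V : Type u
  /-- edges -/
  E : Type v
  /-- range -/
  r : E → V
  /-- source -/
  s : E → V

/-- A graph morphism `F → E`. -/
structure DirGraph.Hom (F E : DirGraph) where
  onV : F.V → E.V
  onE : F.E → E.E
  map_r : ∀ f, E.r (onE f) = onV (F.r f)
  map_s : ∀ f, E.s (onE f) = onV (F.s f)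

/-- Unique `r`-path lifting: for `e ∈ E¹`, `w ∈ F⁰` with `r(e) = p(w)` there is a unique
`f ∈ F¹` with `r(f) = w` and `p(f) = e`. -/
def DirGraph.Hom.UniqueRPathLifting {F E : DirGraph} (p : DirGraph.Hom F E) : Prop :=
  ∀ (e : E.E) (w : F.V), E.r e = p.onV w → ∃! f : F.E, F.r f = w ∧ p.onE f = e

/-- Unique `s`-path lifting: for `e ∈ E¹`, `w ∈ F⁰` with `s(e) = p(w)` there is a unique
`f ∈ F¹` with `s(f) = w` and `p(f) = e`. -/
def DirGraph.Hom.UniqueSPathLifting {F E : DirGraph} (p : DirGraph.Hom F E) : Prop :=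
  ∀ (e : E.E) (w : F.V), E.s e = p.onV w → ∃! f : F.E, F.s f = w ∧ p.onE f = e

/-! ### Coloured graphs and squares -/

/-- A `k`-coloured graph; the colours are the elements of `Fin k`, so that the colour `c_i`
is the element `i - 1`. -/
structure ColGraph (k : ℕ) extends DirGraph where
  /-- colour map -/
  c : E → Fin k

/-- A coloured-graph morphism: a graph morphism that preserves colours. -/
structure ColGraph.Hom {k : ℕ} (F E : ColGraph k) extends
    DirGraph.Hom F.toDirGraph E.toDirGraph where
  map_c : ∀ f, E.c (onE f) = F.c f

/-- Composition of coloured-graph morphisms, first `ψ`, then `φ`. -/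
def ColGraph.Hom.comp {k : ℕ} {D E F : ColGraph k} (φ : ColGraph.Hom E F)
    (ψ : ColGraph.Hom D E) : ColGraph.Hom D F where
  onV x := φ.onV (ψ.onV x)
  onE x := φ.onE (ψ.onE x)
  map_r f := by rw [φ.map_r, ψ.map_r]
  map_s f := by rw [φ.map_s, ψ.map_s]
  map_c f := by rw [φ.map_c, ψ.map_c]

/-- A coloured-graph isomorphism: a coloured-graph morphism that is bijective on vertices and
on edges. -/
def ColGraph.Hom.IsIso {k : ℕ} {E F : ColGraph k} (φ : ColGraph.Hom E F) : Prop :=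
  Function.Bijective φ.onV ∧ Function.Bijective φ.onE

/-- The canonical generator `e_i` of `ℕ^k`. -/
def gen {k : ℕ} (i : Fin k) : Fin k → ℕ := Pi.single i 1

/-- The model `k`-coloured graph `E_{k,m}`: its vertices are the `n ≤ m` in `ℕ^k`, and for each
`n` and `i` with `n + e_i ≤ m` there is an edge `ε_i^n = ⟨(i, n), _⟩` of colour `i` with range
`n` and source `n + e_i`. -/
def modelGraph (k : ℕ) (m : Fin k → ℕ) : ColGraph k where
  V := {n : Fin k → ℕ // n ≤ m}
  E := {a : Fin k × (Fin k → ℕ) // a.2 + gen a.1 ≤ m}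
  r a := ⟨a.1.2, le_trans (le_add_of_nonneg_right zero_le) a.2⟩
  s a := ⟨a.1.2 + gen a.1.1, a.2⟩
  c a := a.1.1

/-- A square in a `2`-coloured graph `G`: a coloured-graph morphism `E_{2,e₁+e₂} → G`. -/
abbrev ColGraph.Square (G : ColGraph 2) :=
  ColGraph.Hom (modelGraph 2 (gen 0 + gen 1)) G

/-- `(G, C)` and `(H, D)` are square-isomorphic: some coloured-graph isomorphism `φ : G → H`
carries the collection of squares `C` onto the collection `D`. -/
def SquareIsomorphic (G : ColGraph 2) (C : Set G.Square) (H : ColGraph 2) (D : Set H.Square) :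
    Prop :=
  ∃ φ : ColGraph.Hom G H, φ.IsIso ∧ (fun ψ : G.Square => φ.comp ψ) '' C = D

/-! ### Higher-rank graphs -/

/-- A `k`-graph: a countable category with a degree functor to `ℕ^k` (here written as a map on
morphisms that sends identities to `0` and composites to sums) that has the factorisation
property. A morphism `f : X ⟶ Y` has source `X` and range `Y`, so the product written `μν` in
the theory of `k`-graphs (with `s(μ) = r(ν)`) is the composite `ν ≫ μ`. -/
structure KGraph (k : ℕ) : Type (max (u + 1) (v + 1)) where
  Obj : Type u
  [cat : Category.{v} Obj]
  countable_mor : Countable (Σ X Y : Obj, X ⟶ Y)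
  deg : ∀ {X Y : Obj}, (X ⟶ Y) → (Fin k → ℕ)
  deg_id : ∀ X : Obj, deg (𝟙 X) = 0
  deg_comp : ∀ {X Y Z : Obj} (ν : X ⟶ Y) (μ : Y ⟶ Z), deg (ν ≫ μ) = deg μ + deg ν
  factorisation : ∀ {X Y : Obj} (x : X ⟶ Y) (m n : Fin k → ℕ), deg x = m + n →
    ∃! t : Σ Z : Obj, (Z ⟶ Y) × (X ⟶ Z),
      deg t.2.1 = m ∧ deg t.2.2 = n ∧ t.2.2 ≫ t.2.1 = x

attribute [instance] KGraph.cat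

/-- An isomorphism of `k`-graphs: a degree-preserving functor that is bijective on objects and
on morphisms. -/
structure KGraph.Iso {k : ℕ} (Λ Γ : KGraph k) where
  toFunctor : Λ.Obj ⥤ Γ.Obj
  bijective_obj : Function.Bijective toFunctor.obj
  bijective_map : ∀ X Y : Λ.Obj,
    Function.Bijective (toFunctor.map : (X ⟶ Y) → (toFunctor.obj X ⟶ toFunctor.obj Y))
  deg_map : ∀ {X Y : Λ.Obj} (f : X ⟶ Y), Γ.deg (toFunctor.map f) = Λ.deg f

namespace KGraph

variable {k : ℕ} (Λ : KGraph k)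

/-- The set of all morphisms of `Λ`; `⟨X, Y, f⟩` has source `X` and range `Y`. -/
abbrev Mor := Σ X Y : Λ.Obj, X ⟶ Y

variable {Λ}

/-- The degree of a morphism. -/
abbrev Mor.d (x : Λ.Mor) : Fin k → ℕ := Λ.deg x.2.2

/-- `y = x(m, n)`: there is a factorisation `x = α y β` with `d(α) = m`, `d(y) = n - m` and
`d(β) = d(x) - n`. -/
def IsSegment (x : Λ.Mor) (m n : Fin k → ℕ) (y : Λ.Mor) : Prop :=
  ∃ (α : y.2.1 ⟶ x.2.1) (β : x.1 ⟶ y.1), β ≫ y.2.2 ≫ α = x.2.2 ∧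
    Λ.deg α = m ∧ m + y.d = n ∧ n + Λ.deg β = x.d

theorem factor_eq {X Y Z Z' : Λ.Obj} {μ : Z ⟶ Y} {ν : X ⟶ Z} {μ' : Z' ⟶ Y} {ν' : X ⟶ Z'}
    (h : ν ≫ μ = ν' ≫ μ') (hd : Λ.deg μ = Λ.deg μ') :
    (⟨Z, μ, ν⟩ : Σ Z : Λ.Obj, (Z ⟶ Y) × (X ⟶ Z)) = ⟨Z', μ', ν'⟩ := by
  have h1 := Λ.deg_comp ν μ
  have h2 := Λ.deg_comp ν' μ'
  refine (Λ.factorisation (ν ≫ μ) _ _ h1).unique ⟨rfl, rfl, rfl⟩ ⟨hd.symm, ?_, h.symm⟩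
  rw [← h, h1, hd] at h2
  exact (add_left_cancel h2).symm

theorem exists_segment (x : Λ.Mor) {m n : Fin k → ℕ} (hmn : m ≤ n) (hn : n ≤ x.d) :
    ∃ y, IsSegment x m n y := by
  obtain ⟨⟨Z, γ, β⟩, ⟨h1, h2, h3⟩, -⟩ := Λ.factorisation x.2.2 n (x.d - n)
    (add_tsub_cancel_of_le hn).symm
  obtain ⟨⟨W, α, y⟩, ⟨h4, h5, h6⟩, -⟩ := Λ.factorisation γ m (n - m)
    (h1.trans (add_tsub_cancel_of_le hmn).symm)
  dsimp only at *
  refine ⟨⟨Z, W, y⟩, α, β, ?_, h4, ?_, ?_⟩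
  · dsimp only
    rw [h6, h3]
  · rw [Mor.d, h5, add_tsub_cancel_of_le hmn]
  · rw [h2, add_tsub_cancel_of_le hn]

theorem IsSegment.src_eq {x y z : Λ.Mor} {m n n' : Fin k → ℕ} (hy : IsSegment x m n y)
    (hz : IsSegment x n n' z) : y.1 = z.2.1 := by
  obtain ⟨α, β, h1, h2, h3, h4⟩ := hy
  obtain ⟨α', β', h1', h2', h3', h4'⟩ := hz
  have key := factor_eq (μ := y.2.2 ≫ α) (ν := β) (μ' := α') (ν' := β' ≫ z.2.2)
    (by rw [h1, Category.assoc, h1']) (by rw [Λ.deg_comp, h2, h2', ← h3])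
  exact congrArg Sigma.fst key

theorem IsSegment.tgt_eq {x y z : Λ.Mor} {m n n' : Fin k → ℕ} (hy : IsSegment x m n y)
    (hz : IsSegment x m n' z) : y.2.1 = z.2.1 := by
  obtain ⟨α, β, h1, h2, h3, h4⟩ := hy
  obtain ⟨α', β', h1', h2', h3', h4'⟩ := hz
  have key := factor_eq (μ := α) (ν := β ≫ y.2.2) (μ' := α') (ν' := β' ≫ z.2.2)
    (by rw [Category.assoc, h1, Category.assoc, h1']) (by rw [h2, h2'])
  exact congrArg Sigma.fst key

theorem IsSegment.unique {x y z : Λ.Mor} {m n : Fin k → ℕ} (hy : IsSegment x m n y)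
    (hz : IsSegment x m n z) : y = z := by
  obtain ⟨a, b, y⟩ := y
  obtain ⟨a', b', z⟩ := z
  obtain ⟨α, β, h1, h2, h3, h4⟩ := hy
  obtain ⟨α', β', h1', h2', h3', h4'⟩ := hz
  dsimp only at *
  have key := factor_eq (μ := α) (ν := β ≫ y) (μ' := α') (ν' := β' ≫ z)
    (by rw [Category.assoc, h1, Category.assoc, h1']) (by rw [h2, h2'])
  rw [Sigma.mk.injEq] at key
  obtain ⟨rfl, key⟩ := key
  rw [heq_eq_eq, Prod.mk.injEq] at key
  have key2 := factor_eq key.2 (add_left_cancel (h3.trans h3'.symm))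
  rw [Sigma.mk.injEq] at key2
  obtain ⟨rfl, key2⟩ := key2
  rw [heq_eq_eq, Prod.mk.injEq] at key2
  rw [key2.1]

/-- The segment `x(m, n)` of a morphism `x`, for `m ≤ n ≤ d(x)`. -/
noncomputable def segment (x : Λ.Mor) (m n : Fin k → ℕ) (hmn : m ≤ n) (hn : n ≤ x.d) : Λ.Mor :=
  (exists_segment x hmn hn).choose

theorem isSegment_segment (x : Λ.Mor) (m n : Fin k → ℕ) (hmn : m ≤ n) (hn : n ≤ x.d) :
    IsSegment x m n (segment x m n hmn hn) :=
  (exists_segment x hmn hn).choose_spec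

theorem segment_d (x : Λ.Mor) (n e : Fin k → ℕ) (hmn : n ≤ n + e) (hn : n + e ≤ x.d) :
    (segment x n (n + e) hmn hn).d = e := by
  obtain ⟨α, β, h1, h2, h3, h4⟩ := isSegment_segment x n (n + e) hmn hn
  exact add_left_cancel h3

variable (Λ) in
/-- The `1`-skeleton of `Λ`: its vertices are the objects of `Λ`, its edges of colour `i` are
the morphisms of degree `e_i` (these sets are disjoint for different `i`), with the range and
source of `Λ`. -/
def skeleton : ColGraph k where
  V := Λ.Obj
  E := Σ i : Fin k, {x : Λ.Mor // x.d = gen i}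
  r a := a.2.1.2.1
  s a := a.2.1.1
  c a := a.1

/-- For a morphism `x` of degree `m`, the coloured-graph morphism `φ_x : E_{k,m} → Sk_Λ` with
`φ_x(n) = x(n, n)` and `φ_x(ε_l^n) = x(n, n + e_l)`. -/
noncomputable def pathHom (x : Λ.Mor) (m : Fin k → ℕ) (h : x.d = m) :
    ColGraph.Hom (modelGraph k m) Λ.skeleton where
  onV n := (segment x n.1 n.1 le_rfl (n.2.trans h.ge)).2.1
  onE a := ⟨a.1.1, segment x a.1.2 (a.1.2 + gen a.1.1) (le_add_of_nonneg_right zero_le)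
    (a.2.trans h.ge), segment_d _ _ _ _ _⟩
  map_r a := (isSegment_segment x a.1.2 (a.1.2 + gen a.1.1)
    (le_add_of_nonneg_right zero_le) (a.2.trans h.ge)).tgt_eq (isSegment_segment x _ _ _ _)
  map_s a := (isSegment_segment x a.1.2 (a.1.2 + gen a.1.1)
    (le_add_of_nonneg_right zero_le) (a.2.trans h.ge)).src_eq (isSegment_segment x _ _ _ _)
  map_c _ := rfl

/-- The canonical collection of squares of a `2`-graph:
`C_Λ = {φ_x : x a morphism of degree e₁ + e₂}`. -/
def squares (Λ : KGraph 2) : Set Λ.skeleton.Square :=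
  {φ | ∃ (x : Λ.Mor) (h : x.d = gen 0 + gen 1), φ = pathHom x _ h}

end KGraph

/-! ### Textile systems -/

/-- A textile system `(E, F, p, q)`. -/
structure TextileSystem where
  E : DirGraph.{u, u}
  F : DirGraph.{u, u}
  p : DirGraph.Hom F E
  q : DirGraph.Hom F E
  injective : Function.Injective fun f : F.E => (p.onE f, q.onE f, F.r f, F.s f)

namespace TextileSystem

variable (T : TextileSystem.{u})

/-- The `2`-coloured graph `G_T`: vertices `E⁰`, edges the disjoint union of `E¹` (colour `c₁`,
with the range and source of `E`) and `F⁰` (colour `c₂`, with range `q(w)` and source `p(w)`). -/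
def graph : ColGraph.{u, u} 2 where
  V := T.E.V
  E := T.E.E ⊕ T.F.V
  r := Sum.elim T.E.r T.q.onV
  s := Sum.elim T.E.s T.p.onV
  c := Sum.elim (fun _ => 0) (fun _ => 1)

/-- For `f ∈ F¹`, the square `φ_f` in `G_T` with
`φ_f(ε₁^0) = q(f)`, `φ_f(ε₁^{e₂}) = p(f)`, `φ_f(ε₂^0) = r(f)`, `φ_f(ε₂^{e₁}) = s(f)`. -/
def square (f : T.F.E) : T.graph.Square where
  onV n :=
    if n.1 0 = 0 then
      if n.1 1 = 0 then T.q.onV (T.F.r f) else T.p.onV (T.F.r f)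
    else
      if n.1 1 = 0 then T.q.onV (T.F.s f) else T.p.onV (T.F.s f)
  onE a :=
    if a.1.1 = 0 then
      if a.1.2 1 = 0 then Sum.inl (T.q.onE f) else Sum.inl (T.p.onE f)
    else
      if a.1.2 0 = 0 then Sum.inr (T.F.r f) else Sum.inr (T.F.s f)
  map_r := by
    rintro ⟨⟨i, n⟩, h⟩
    have h0 := h 0
    have h1 := h 1
    fin_cases i <;> simp [gen, modelGraph, graph] at h0 h1 ⊢ <;> split_ifs <;>
      simp_all [T.p.map_r, T.q.map_r]
  map_s := by
    rintro ⟨⟨i, n⟩, h⟩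
    have h0 := h 0
    have h1 := h 1
    fin_cases i <;> simp [gen, modelGraph, graph] at h0 h1 ⊢ <;> split_ifs <;>
      simp_all [T.p.map_s, T.q.map_s]
  map_c := by
    rintro ⟨⟨i, n⟩, h⟩
    fin_cases i <;> simp [modelGraph, graph] <;> split_ifs <;> simp

/-- The collection of squares `C_T = {φ_f : f ∈ F¹}` in `G_T`. -/
def squares : Set T.graph.Square := Set.range T.square

/-- `(Sk_Λ, C_Λ) ≅ (G_T, C_T)`: the `1`-skeleton of the `2`-graph `Λ` with its canonical squares
is square-isomorphic to the `2`-coloured graph of `T` with its squares. -/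
def Presents (Λ : KGraph.{v, w} 2) : Prop :=
  SquareIsomorphic Λ.skeleton Λ.squares T.graph T.squares

end TextileSystem

/-! Call the edges of `E` blue and the vertices of `F` red. In a 2-graph, the factorisation property
gives each morphism exactly one word of edges for each colour order compatible with its degree, and
the squares say how two adjacent letters of different colours are exchanged. An edge `f` of `F`
exchanges the red-blue word `r(f) p(f)` with the blue-red word `q(f) s(f)`. Unique `r`-path lifting
of `p` says that every composable red-blue pair comes from exactly one `f`; unique `s`-path lifting
of `q` says this of blue-red pairs.

For existence, the morphisms are the paths in normal form, blue letters before red ones. The product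
slides the red part of the left factor past the blue part of the right factor (`slideMul`). With two
colours this is associative for any exchange rule (`slideMul_assoc`). Lifting for `p` keeps paths
paths; both liftings make sliding invertible on paths (`exists_slide_eq`, `slide_inj`), which is the
factorisation property.

Conversely, let `Λ` present `T`. A composable two-coloured pair labels a morphism of degree `e₁ +
e₂`, whose square supplies the required lift; injectivity of the textile system makes it unique.
Exchanging letters does not change the labelled morphism (`swapInvariant_labels`), so taking normal
forms is an isomorphism onto the 2-graph of paths (`nonempty_iso_kGraph`). Any two 2-graphs that
present `T` are compared through it. -/

/-! ### Squares and their edges -/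

/-- The edge of colour `i` of the model square whose range is `0`. -/
def rangeEdge (i : Fin 2) : (modelGraph 2 (gen 0 + gen 1)).E :=
  ⟨(i, 0), by intro j; fin_cases i <;> fin_cases j <;> simp [gen]⟩

/-- The edge of the model square that follows `rangeEdge i`. -/
def sourceEdge (i : Fin 2) : (modelGraph 2 (gen 0 + gen 1)).E :=
  ⟨(i.rev, gen i), by intro j; fin_cases i <;> fin_cases j <;> simp [gen]⟩

theorem gen_add_gen_rev (i : Fin 2) : gen i + gen i.rev = gen 0 + gen 1 := by
  fin_cases i
  · rfl
  · exact add_comm _ _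

theorem eq_rangeEdge_or_sourceEdge (a : (modelGraph 2 (gen 0 + gen 1)).E) :
    ∃ i, a = rangeEdge i ∨ a = sourceEdge i := by
  obtain ⟨⟨i, n⟩, h⟩ := a
  have h0 := h 0
  have h1 := h 1
  have key : n = 0 ∨ n = gen i.rev := by
    fin_cases i <;> simp [gen, funext_iff, Fin.forall_fin_two] at h0 h1 ⊢ <;> omega
  rcases key with rfl | rfl
  · exact ⟨i, Or.inl rfl⟩
  -- `rev` swaps the two colours, so the edge that follows `rangeEdge i.rev` has colour `i`.
  · refine ⟨i.rev, Or.inr (Subtype.ext ?_)⟩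
    simp [sourceEdge]

theorem exists_edge_of_vertex (n : (modelGraph 2 (gen 0 + gen 1)).V) :
    ∃ a, n = (modelGraph 2 (gen 0 + gen 1)).r a ∨ n = (modelGraph 2 (gen 0 + gen 1)).s a := by
  obtain ⟨n, h⟩ := n
  have h0 := h 0
  have h1 := h 1
  have key : n = 0 ∨ n = gen 0 ∨ n = gen 1 ∨ n = gen 0 + gen 1 := by
    simp [gen, funext_iff, Fin.forall_fin_two] at h0 h1 ⊢
    omega
  rcases key with rfl | rfl | rfl | rfl
  · exact ⟨rangeEdge 0, Or.inl rfl⟩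
  · exact ⟨sourceEdge 0, Or.inl rfl⟩
  · exact ⟨sourceEdge 1, Or.inl rfl⟩
  · exact ⟨sourceEdge 0, Or.inr rfl⟩

theorem ColGraph.Hom.ext_of {k : ℕ} {G H : ColGraph k} {φ ψ : ColGraph.Hom G H}
    (hV : φ.onV = ψ.onV) (hE : φ.onE = ψ.onE) : φ = ψ := by
  obtain ⟨⟨_, _, _, _⟩, _⟩ := φ
  obtain ⟨⟨_, _, _, _⟩, _⟩ := ψ
  dsimp only at hV hE
  subst hV hE
  rfl

/-- The model square has no isolated vertex, so the four edges already force the map on vertices. -/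
theorem ColGraph.square_ext {G : ColGraph 2} {φ ψ : G.Square}
    (h : ∀ i, φ.onE (rangeEdge i) = ψ.onE (rangeEdge i) ∧
      φ.onE (sourceEdge i) = ψ.onE (sourceEdge i)) : φ = ψ := by
  have hE : φ.onE = ψ.onE := by
    funext a
    obtain ⟨i, rfl | rfl⟩ := eq_rangeEdge_or_sourceEdge a
    exacts [(h i).1, (h i).2]
  refine ColGraph.Hom.ext_of (funext fun n => ?_) hE
  obtain ⟨a, rfl | rfl⟩ := exists_edge_of_vertex n
  · rw [← φ.map_r, ← ψ.map_r, hE]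
  · rw [← φ.map_s, ← ψ.map_s, hE]

theorem SquareIsomorphic.symm {G H : ColGraph 2} {C : Set G.Square} {D : Set H.Square}
    (h : SquareIsomorphic G C H D) : SquareIsomorphic H D G C := by
  obtain ⟨φ, ⟨hV, hE⟩, rfl⟩ := h
  let eV := Equiv.ofBijective _ hV
  let eE := Equiv.ofBijective _ hE
  have hV1 : ∀ x, φ.onV (eV.symm x) = x := eV.apply_symm_apply
  have hE1 : ∀ x, φ.onE (eE.symm x) = x := eE.apply_symm_apply
  have hV2 : ∀ x, eV.symm (φ.onV x) = x := eV.symm_apply_apply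
  have hE2 : ∀ x, eE.symm (φ.onE x) = x := eE.symm_apply_apply
  let χ : ColGraph.Hom H G :=
    { onV := eV.symm
      onE := eE.symm
      map_r := fun f => hV.1 (by rw [← φ.map_r, hE1, hV1])
      map_s := fun f => hV.1 (by rw [← φ.map_s, hE1, hV1])
      map_c := fun f => by rw [← φ.map_c, hE1] }
  refine ⟨χ, ⟨eV.symm.bijective, eE.symm.bijective⟩, ?_⟩
  rw [Set.image_image]
  refine Eq.trans (Set.image_congr fun ψ _ => ?_) (Set.image_id' C)
  exact ColGraph.Hom.ext_of (funext fun n => hV2 _) (funext fun a => hE2 _)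

/-! ### Paths in coloured graphs -/

/-- `G.IsPath y l x`: the word `l` of edges of `G` is a path with range `y` and source `x`. -/
def ColGraph.IsPath {k : ℕ} (G : ColGraph k) : G.V → List G.E → G.V → Prop
  | y, [], x => y = x
  | y, e :: l, x => G.r e = y ∧ G.IsPath (G.s e) l x

theorem ColGraph.isPath_append {k : ℕ} {G : ColGraph k} {y x : G.V} {l l' : List G.E} :
    G.IsPath y (l ++ l') x ↔ ∃ z, G.IsPath y l z ∧ G.IsPath z l' x := by
  induction l generalizing y with
  | nil => simp [ColGraph.IsPath]
  | cons e l ih => simp [ColGraph.IsPath, ih, and_assoc]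

theorem ColGraph.IsPath.source_unique {k : ℕ} {G : ColGraph k} {y x x' : G.V} {l : List G.E}
    (h : G.IsPath y l x) (h' : G.IsPath y l x') : x = x' := by
  induction l generalizing y with
  | nil => exact h.symm.trans h'
  | cons e l ih => exact ih h.2 h'.2

/-! ### Composition and words in `k`-graphs -/

namespace KGraph

section

variable {k : ℕ} {Λ : KGraph.{v, w} k}

/-- Both `1 · f` and `f · 1` factor `f` with a left factor of degree `0`, and such a factorisation
is unique. -/
theorem eq_eqToHom_of_deg_eq_zero {X Y : Λ.Obj} {f : X ⟶ Y} (hf : Λ.deg f = 0) :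
    ∃ h : X = Y, f = eqToHom h := by
  have key := factor_eq (μ := 𝟙 Y) (ν := f) (μ' := f) (ν' := 𝟙 X) (by simp)
    (by rw [Λ.deg_id, hf])
  rw [Sigma.mk.injEq] at key
  obtain ⟨rfl, key⟩ := key
  rw [heq_eq_eq, Prod.mk.injEq] at key
  exact ⟨rfl, key.2⟩

/-- `IsComp y z x`: the morphism `x` is the product `yz`. -/
inductive IsComp : Λ.Mor → Λ.Mor → Λ.Mor → Prop
  | mk {X Y Z : Λ.Obj} (ν : X ⟶ Y) (μ : Y ⟶ Z) : IsComp ⟨Y, Z, μ⟩ ⟨X, Y, ν⟩ ⟨X, Z, ν ≫ μ⟩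

theorem IsComp.d_eq {x y z : Λ.Mor} (h : IsComp y z x) : x.d = y.d + z.d := by
  cases h
  exact Λ.deg_comp _ _

theorem IsComp.isSegment_left {x y z : Λ.Mor} (h : IsComp y z x) : IsSegment x 0 (0 + y.d) y := by
  have := h.d_eq
  cases h with
  | mk ν μ => exact ⟨𝟙 _, ν, by simp, Λ.deg_id _, rfl, by rw [this, zero_add]⟩

theorem IsComp.isSegment_right {x y z : Λ.Mor} (h : IsComp y z x) :
    IsSegment x y.d (y.d + z.d) z := by
  have := h.d_eq
  cases h with
  | mk ν μ => exact ⟨μ, 𝟙 _, by simp, rfl, rfl, by rw [this, Λ.deg_id, add_zero]⟩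

theorem IsSegment.isComp {x y z : Λ.Mor} {m n : Fin k → ℕ} (hy : IsSegment x 0 m y)
    (hz : IsSegment x m n z) (hn : n = x.d) : IsComp y z x := by
  obtain ⟨X, Y, x⟩ := x
  obtain ⟨Y₁, Y₂, y⟩ := y
  obtain ⟨Z₁, Z₂, z⟩ := z
  obtain ⟨α, β, h1, h2, h3, h4⟩ := hy
  obtain ⟨α', β', h1', h2', h3', h4'⟩ := hz
  dsimp only at *
  rw [hn] at h4'
  obtain ⟨rfl, rfl⟩ := eq_eqToHom_of_deg_eq_zero h2
  obtain ⟨rfl, rfl⟩ := eq_eqToHom_of_deg_eq_zero (add_eq_left.1 h4')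
  simp only [eqToHom_refl, Category.comp_id, Category.id_comp] at h1 h1'
  have key := factor_eq (h1.trans h1'.symm) (by rw [h2', ← h3, zero_add])
  rw [Sigma.mk.injEq] at key
  obtain ⟨rfl, key⟩ := key
  rw [heq_eq_eq, Prod.mk.injEq] at key
  rw [key.2] at h1
  subst h1
  exact IsComp.mk _ _

theorem isSegment_pathHom_onE {x : Λ.Mor} {m : Fin k → ℕ} (h : x.d = m) (a : (modelGraph k m).E) :
    IsSegment x a.1.2 (a.1.2 + gen a.1.1) ((pathHom x m h).onE a).2.1 :=
  isSegment_segment x _ _ (le_add_of_nonneg_right zero_le) (a.2.trans h.ge)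

theorem isComp_pathHom {Λ : KGraph.{v, w} 2} {x : Λ.Mor} (h : x.d = gen 0 + gen 1) (i : Fin 2) :
    IsComp ((pathHom x _ h).onE (rangeEdge i)).2.1 ((pathHom x _ h).onE (sourceEdge i)).2.1 x := by
  have h1 := isSegment_pathHom_onE h (rangeEdge i)
  have h2 := isSegment_pathHom_onE h (sourceEdge i)
  dsimp only [rangeEdge, sourceEdge] at h1 h2
  rw [zero_add] at h1
  exact h1.isComp h2 (by rw [h, gen_add_gen_rev])

/-- The edges of `ψ` are initial and final segments of `x`; segments are unique, and a square is
determined by its edges. -/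
theorem eq_pathHom {Λ : KGraph.{v, w} 2} {ψ : Λ.skeleton.Square} {x : Λ.Mor}
    (hx : ∀ i, IsComp (ψ.onE (rangeEdge i)).2.1 (ψ.onE (sourceEdge i)).2.1 x) :
    ∃ h : x.d = gen 0 + gen 1, ψ = pathHom x _ h := by
  have hr : ∀ (χ : Λ.skeleton.Square) i, (χ.onE (rangeEdge i)).1 = i := fun χ i => χ.map_c _
  have hs : ∀ (χ : Λ.skeleton.Square) i, (χ.onE (sourceEdge i)).1 = i.rev := fun χ i => χ.map_c _
  have hrd : ∀ i, (ψ.onE (rangeEdge i)).2.1.d = gen i := fun i => by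
    rw [(ψ.onE (rangeEdge i)).2.2, hr]
  have hsd : ∀ i, (ψ.onE (sourceEdge i)).2.1.d = gen i.rev := fun i => by
    rw [(ψ.onE (sourceEdge i)).2.2, hs]
  have hd : x.d = gen 0 + gen 1 := by
    rw [(hx 0).d_eq, hrd, hsd]
    rfl
  have edge_ext : ∀ e e' : Λ.skeleton.E, e.1 = e'.1 → e.2.1 = e'.2.1 → e = e' := by
    rintro ⟨i, x, h⟩ ⟨j, y, h'⟩ h1 h2
    dsimp only at h1 h2
    subst h1 h2
    rfl
  refine ⟨hd, ColGraph.square_ext fun i => ⟨edge_ext _ _ (by rw [hr, hr]) ?_,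
    edge_ext _ _ (by rw [hs, hs]) ?_⟩⟩
  · have := (hx i).isSegment_left
    rw [hrd] at this
    exact this.unique (isSegment_pathHom_onE hd _)
  · have := (hx i).isSegment_right
    rw [hrd, hsd] at this
    exact this.unique (isSegment_pathHom_onE hd _)

/-- Trades segments for commutativity: a square is canonical exactly when its two sides have the
same product. -/
theorem mem_squares_iff {Λ : KGraph.{v, w} 2} {ψ : Λ.skeleton.Square} :
    ψ ∈ Λ.squares ↔ ∃ x : Λ.Mor, ∀ i,
      IsComp (ψ.onE (rangeEdge i)).2.1 (ψ.onE (sourceEdge i)).2.1 x := by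
  constructor
  · rintro ⟨x, h, rfl⟩
    exact ⟨x, isComp_pathHom h⟩
  · rintro ⟨x, hx⟩
    obtain ⟨h, rfl⟩ := eq_pathHom hx
    exact ⟨x, h, rfl⟩

/-- The edge of the skeleton given by a morphism `μ` of degree `gen i`. -/
def edge {X Y : Λ.Obj} {i : Fin k} (μ : X ⟶ Y) (h : Λ.deg μ = gen i) : Λ.skeleton.E :=
  ⟨i, ⟨X, Y, μ⟩, h⟩

theorem edge_fst {X Y : Λ.Obj} {i : Fin k} (μ : X ⟶ Y) (h : Λ.deg μ = gen i) :
    (edge μ h).1 = i := rfl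

theorem exists_eq_edge (e : Λ.skeleton.E) :
    ∃ (X Y : Λ.Obj) (i : Fin k) (μ : X ⟶ Y) (h : Λ.deg μ = gen i), e = edge μ h :=
  ⟨_, _, _, _, e.2.2, rfl⟩

/-! ### Morphisms as words of labelled edges -/

variable {ι : Type*}

/-- `Labels lab l f`: the morphism `f` is a product of edges whose labels under `lab` form the
word `l`, read from the range to the source. -/
def Labels (lab : Λ.skeleton.E → ι) : List ι → ∀ {X Y : Λ.Obj}, (X ⟶ Y) → Prop
  | [], _, _, f => Λ.deg f = 0
  | e :: l, X, Y, f => ∃ (Z : Λ.Obj) (μ : Z ⟶ Y) (ν : X ⟶ Z) (i : Fin k) (h : Λ.deg μ = gen i),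
      ν ≫ μ = f ∧ lab (edge μ h) = e ∧ Labels lab l ν

variable {lab : Λ.skeleton.E → ι}

theorem labels_append {l l' : List ι} {X Y : Λ.Obj} {f : X ⟶ Y} :
    Labels lab (l ++ l') f ↔ ∃ (Z : Λ.Obj) (μ : Z ⟶ Y) (ν : X ⟶ Z),
      ν ≫ μ = f ∧ Labels lab l μ ∧ Labels lab l' ν := by
  induction l generalizing Y with
  | nil =>
    constructor
    · exact fun h => ⟨Y, 𝟙 Y, f, Category.comp_id f, Λ.deg_id Y, h⟩
    · rintro ⟨Z, μ, ν, rfl, hμ, hν⟩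
      obtain ⟨rfl, rfl⟩ := eq_eqToHom_of_deg_eq_zero hμ
      simpa using hν
  | cons e l ih =>
    constructor
    · rintro ⟨Z, μ, ν, i, h, rfl, he, hν⟩
      obtain ⟨W, μ', ν', rfl, hl, hl'⟩ := ih.1 hν
      exact ⟨W, μ' ≫ μ, ν', by simp, ⟨Z, μ, μ', i, h, rfl, he, hl⟩, hl'⟩
    · rintro ⟨Z, _, ν, rfl, ⟨W, μ, μ', i, h, rfl, he, hl⟩, hl'⟩
      exact ⟨W, μ, ν ≫ μ', i, h, by simp, he, ih.2 ⟨Z, μ', ν, rfl, hl, hl'⟩⟩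

theorem labels_id (X : Λ.Obj) : Labels lab [] (𝟙 X) := Λ.deg_id X

theorem labels_singleton (e : Λ.skeleton.E) : Labels lab [lab e] e.2.1.2.2 :=
  ⟨_, _, 𝟙 _, e.1, e.2.2, Category.id_comp _, rfl, Λ.deg_id _⟩

theorem IsComp.labels {e e' : Λ.skeleton.E} {x : Λ.Mor} (h : IsComp e.2.1 e'.2.1 x) :
    Labels lab [lab e, lab e'] x.2.2 := by
  obtain ⟨i, y, hy⟩ := e
  obtain ⟨j, z, hz⟩ := e'
  cases h with
  | mk ν μ => exact ⟨_, μ, ν, i, hy, rfl, rfl, labels_singleton ⟨j, _, hz⟩⟩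

/-- Injective labels give back the edges, and the edges compose to the morphism. The common range
`Y` has to be prescribed because the empty word does not determine it. -/
theorem Labels.unique (hlab : Function.Injective lab) {l : List ι} {X X' Y : Λ.Obj} {f : X ⟶ Y}
    {f' : X' ⟶ Y} (h : Labels lab l f) (h' : Labels lab l f') :
    (⟨X, f⟩ : Σ X : Λ.Obj, X ⟶ Y) = ⟨X', f'⟩ := by
  induction l generalizing Y with
  | nil =>
    obtain ⟨rfl, rfl⟩ := eq_eqToHom_of_deg_eq_zero h
    obtain ⟨rfl, rfl⟩ := eq_eqToHom_of_deg_eq_zero h'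
    rfl
  | cons e l ih =>
    obtain ⟨Z, μ, ν, i, hμ, rfl, he, hν⟩ := h
    obtain ⟨Z', μ', ν', i', hμ', rfl, he', hν'⟩ := h'
    have key := hlab (he.trans he'.symm)
    have k1 : i = i' := congrArg Sigma.fst key
    subst k1
    have k2 := Subtype.mk.inj (eq_of_heq (Sigma.mk.inj key).2)
    rw [Sigma.mk.injEq] at k2
    obtain ⟨rfl, k2⟩ := k2
    have k3 := eq_of_heq (Sigma.mk.inj (eq_of_heq k2)).2
    subst k3
    have := ih hν hν'
    rw [Sigma.mk.injEq] at this
    obtain ⟨rfl, k4⟩ := this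
    rw [eq_of_heq k4]

variable {c : ι → Fin k}

theorem Labels.deg_eq (hc : ∀ e, c (lab e) = e.1) {l : List ι} {X Y : Λ.Obj} {f : X ⟶ Y}
    (h : Labels lab l f) : Λ.deg f = ((l.map c).map gen).sum := by
  induction l generalizing Y with
  | nil => exact h
  | cons e l ih =>
    obtain ⟨Z, μ, ν, i, hμ, rfl, rfl, hν⟩ := h
    rw [Λ.deg_comp, ih hν, hμ, List.map_cons, List.map_cons, List.sum_cons, hc, edge_fst]

/-- The colours prescribe the degrees of the successive factors, so unique factorisation fixes each
edge in turn. -/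
theorem Labels.word_unique (hc : ∀ e, c (lab e) = e.1) {l l' : List ι} {X Y : Λ.Obj} {f : X ⟶ Y}
    (h : Labels lab l f) (h' : Labels lab l' f) (hl : l.map c = l'.map c) : l = l' := by
  induction l generalizing Y l' with
  | nil => exact (List.map_eq_nil_iff.1 hl.symm).symm
  | cons e l ih =>
    obtain _ | ⟨e', l'⟩ := l'
    · simp at hl
    rw [List.map_cons, List.map_cons, List.cons.injEq] at hl
    obtain ⟨Z, μ, ν, i, hμ, rfl, rfl, hν⟩ := h
    obtain ⟨Z', μ', ν', i', hμ', hf, rfl, hν'⟩ := h'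
    have hi := hl.1
    rw [hc, hc, edge_fst, edge_fst] at hi
    subst hi
    have key := factor_eq hf (hμ'.trans hμ.symm)
    rw [Sigma.mk.injEq] at key
    obtain ⟨rfl, key⟩ := key
    rw [heq_eq_eq, Prod.mk.injEq] at key
    obtain ⟨rfl, rfl⟩ := key
    rw [ih hν hν' hl.2]

theorem exists_labels (hc : ∀ e, c (lab e) = e.1) (l : List (Fin k)) {X Y : Λ.Obj} (f : X ⟶ Y)
    (h : Λ.deg f = (l.map gen).sum) : ∃ l' : List ι, l'.map c = l ∧ Labels lab l' f := by
  induction l generalizing Y with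
  | nil => exact ⟨[], rfl, h⟩
  | cons i l ih =>
    obtain ⟨⟨Z, μ, ν⟩, ⟨h1, h2, h3⟩, -⟩ := Λ.factorisation f (gen i) _ (by rw [h]; rfl)
    obtain ⟨l', rfl, hl'⟩ := ih ν h2
    exact ⟨lab (edge μ h1) :: l', by rw [List.map_cons, hc, edge_fst],
      Z, μ, ν, i, h1, h3, rfl, hl'⟩

theorem Labels.isPath {G : ColGraph k} (φ : ColGraph.Hom Λ.skeleton G) {l : List G.E} {X Y : Λ.Obj}
    {f : X ⟶ Y} (h : Labels φ.onE l f) : G.IsPath (φ.onV Y) l (φ.onV X) := by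
  induction l generalizing Y with
  | nil =>
    obtain ⟨rfl, -⟩ := eq_eqToHom_of_deg_eq_zero h
    rfl
  | cons e l ih =>
    obtain ⟨Z, μ, ν, i, hμ, rfl, rfl, hν⟩ := h
    refine ⟨φ.map_r _, ?_⟩
    rw [φ.map_s]
    exact ih hν

theorem exists_labels_of_isPath {G : ColGraph k} (φ : ColGraph.Hom Λ.skeleton G) (hφ : φ.IsIso)
    {l : List G.E} {X Y : Λ.Obj} (h : G.IsPath (φ.onV Y) l (φ.onV X)) :
    ∃ f : X ⟶ Y, Labels φ.onE l f := by
  induction l generalizing Y with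
  | nil =>
    obtain rfl := hφ.1.1 h
    exact ⟨𝟙 Y, Λ.deg_id Y⟩
  | cons e l ih =>
    obtain ⟨e, rfl⟩ := hφ.2.2 e
    obtain ⟨Z, Y', i, μ, hμ, rfl⟩ := exists_eq_edge e
    obtain ⟨h1, h2⟩ := h
    rw [φ.map_r] at h1
    rw [φ.map_s] at h2
    obtain rfl : Y' = Y := hφ.1.1 h1
    obtain ⟨ν, hν⟩ := ih h2
    exact ⟨ν ≫ μ, Z, μ, ν, i, hμ, rfl, rfl, hν⟩

end

/-! ### Isomorphisms of `k`-graphs -/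

/-- Composition of isomorphisms of `k`-graphs. -/
def Iso.trans {k : ℕ} {Λ Γ Δ : KGraph k} (F : KGraph.Iso Λ Γ) (G : KGraph.Iso Γ Δ) :
    KGraph.Iso Λ Δ where
  toFunctor := F.toFunctor ⋙ G.toFunctor
  bijective_obj := G.bijective_obj.comp F.bijective_obj
  bijective_map X Y := (G.bijective_map _ _).comp (F.bijective_map X Y)
  deg_map f := (G.deg_map _).trans (F.deg_map f)

theorem deg_conj_eqToHom {k : ℕ} {Λ : KGraph k} {X X' Y Y' : Λ.Obj} (h : X = X') (f : X' ⟶ Y')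
    (h' : Y' = Y) : Λ.deg (eqToHom h ≫ f ≫ eqToHom h') = Λ.deg f := by
  subst h h'
  simp

/-- The inverse of an isomorphism of `k`-graphs. -/
noncomputable def Iso.symm {k : ℕ} {Λ Γ : KGraph k} (F : KGraph.Iso Λ Γ) : KGraph.Iso Γ Λ :=
  let e := Equiv.ofBijective _ F.bijective_obj
  have he : ∀ X, F.toFunctor.obj (e.symm X) = X := e.apply_symm_apply
  let m : ∀ X Y : Λ.Obj, (X ⟶ Y) ≃ (F.toFunctor.obj X ⟶ F.toFunctor.obj Y) :=
    fun X Y => Equiv.ofBijective _ (F.bijective_map X Y)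
  have hm : ∀ {X Y : Λ.Obj} (f : F.toFunctor.obj X ⟶ F.toFunctor.obj Y),
      F.toFunctor.map ((m X Y).symm f) = f := fun {X Y} f => (m X Y).apply_symm_apply f
  { toFunctor :=
      { obj := e.symm
        map := fun {X Y} f => (m _ _).symm (eqToHom (he X) ≫ f ≫ eqToHom (he Y).symm)
        map_id := fun X => (F.bijective_map _ _).1 (by rw [hm]; simp)
        map_comp := fun f g => (F.bijective_map _ _).1 (by
          rw [F.toFunctor.map_comp, hm, hm, hm]; simp) }
    bijective_obj := e.symm.bijective
    bijective_map := fun X Y => by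
      refine (m _ _).symm.bijective.comp ⟨fun f g h => ?_, fun f => ?_⟩
      · exact (cancel_mono _).1 ((cancel_epi _).1 h)
      · exact ⟨eqToHom (he X).symm ≫ f ≫ eqToHom (he Y), by simp⟩
    deg_map := fun f => by
      rw [← F.deg_map, hm, deg_conj_eqToHom] }

end KGraph

/-! ### Sliding one list past another -/

section Slide

variable {A B : Type*} (σ : B → A → A × B)

/-- Slide the letter `b` to the right past a list, one letter at a time by means of `σ`. -/
def slideOne : B → List A → List A × B
  | b, [] => ([], b)
  | b, a :: l => ((σ b a).1 :: (slideOne (σ b a).2 l).1, (slideOne (σ b a).2 l).2)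

/-- Slide a list to the right past another list. -/
def slide : List B → List A → List A × List B
  | [], α => (α, [])
  | b :: β, α => ((slideOne σ b (slide β α).1).1, (slideOne σ b (slide β α).1).2 :: (slide β α).2)

/-- The product of two pairs of lists: `(α, β) (α', β') = (α (β ▷ α'), (β ◁ α') β')`. -/
def slideMul (x y : List A × List B) : List A × List B :=
  (x.1 ++ (slide σ x.2 y.1).1, (slide σ x.2 y.1).2 ++ y.2)

theorem slideOne_append (b : B) (α α' : List A) :
    slideOne σ b (α ++ α') = ((slideOne σ b α).1 ++ (slideOne σ (slideOne σ b α).2 α').1,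
      (slideOne σ (slideOne σ b α).2 α').2) := by
  induction α generalizing b with
  | nil => rfl
  | cons a α ih => simp [slideOne, ih]

theorem slide_append_left (β β' : List B) (α : List A) :
    slide σ (β ++ β') α = ((slide σ β (slide σ β' α).1).1,
      (slide σ β (slide σ β' α).1).2 ++ (slide σ β' α).2) := by
  induction β with
  | nil => simp [slide]
  | cons b β ih => simp [slide, ih]

theorem slide_append_right (β : List B) (α α' : List A) :
    slide σ β (α ++ α') = ((slide σ β α).1 ++ (slide σ (slide σ β α).2 α').1,
      (slide σ (slide σ β α).2 α').2) := by
  induction β generalizing α' with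
  | nil => simp [slide]
  | cons b β ih => simp [slide, ih, slideOne_append]

theorem slide_nil_right (β : List B) : slide σ β [] = ([], β) := by
  induction β with
  | nil => rfl
  | cons b β ih => simp [slide, ih, slideOne]

theorem length_slideOne (b : B) (α : List A) : (slideOne σ b α).1.length = α.length := by
  induction α generalizing b with
  | nil => rfl
  | cons a α ih => simp [slideOne, ih]

theorem length_slide_fst (β : List B) (α : List A) : (slide σ β α).1.length = α.length := by
  induction β with
  | nil => rfl
  | cons b β ih => simp [slide, length_slideOne, ih]

theorem length_slide_snd (β : List B) (α : List A) : (slide σ β α).2.length = β.length := by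
  induction β with
  | nil => rfl
  | cons b β ih => simp [slide, ih]

/-- The two append lemmas say that sliding is a matched pair of actions of two free monoids, and
`slideMul` is the product of the corresponding Zappa–Szép monoid. Nothing is required of `σ`: a
consistency condition on the exchanges would first appear with three colours. -/
theorem slideMul_assoc (x y z : List A × List B) :
    slideMul σ (slideMul σ x y) z = slideMul σ x (slideMul σ y z) := by
  simp [slideMul, slide_append_left, slide_append_right]

theorem slideMul_one (x : List A × List B) : slideMul σ x ([], []) = x := by
  simp [slideMul, slide_nil_right]

theorem one_slideMul (x : List A × List B) : slideMul σ ([], []) x = x := by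
  simp [slideMul, slide]

theorem slide_singleton (b : B) (a : A) : slide σ [b] [a] = ([(σ b a).1], [(σ b a).2]) := rfl

end Slide

/-! ### Words in the `2`-coloured graph of a textile system -/

namespace TextileSystem

section

variable (T : TextileSystem.{u})

/-- An edge of `E`, as an edge of the first colour of `T.graph`. -/
def blue (a : T.E.E) : T.graph.E := Sum.inl a

/-- A vertex of `F`, as an edge of the second colour of `T.graph`. -/
def red (b : T.F.V) : T.graph.E := Sum.inr b

theorem blue_injective : Function.Injective T.blue := Sum.inl_injective

theorem red_injective : Function.Injective T.red := Sum.inr_injective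

theorem r_blue (a : T.E.E) : T.graph.r (T.blue a) = T.E.r a := rfl

theorem s_blue (a : T.E.E) : T.graph.s (T.blue a) = T.E.s a := rfl

theorem r_red (b : T.F.V) : T.graph.r (T.red b) = T.q.onV b := rfl

theorem s_red (b : T.F.V) : T.graph.s (T.red b) = T.p.onV b := rfl

theorem c_blue (a : T.E.E) : T.graph.c (T.blue a) = 0 := rfl

theorem c_red (b : T.F.V) : T.graph.c (T.red b) = 1 := rfl

theorem eq_blue_of_color {e : T.graph.E} (h : T.graph.c e = 0) : ∃ a, e = T.blue a := by
  obtain a | b := e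
  · exact ⟨a, rfl⟩
  · exact absurd h (by change ¬ (1 : Fin 2) = 0; decide)

theorem eq_red_of_color {e : T.graph.E} (h : T.graph.c e = 1) : ∃ b, e = T.red b := by
  obtain a | b := e
  · exact absurd h (by change ¬ (0 : Fin 2) = 1; decide)
  · exact ⟨b, rfl⟩

theorem square_onE_rangeEdge_zero (f : T.F.E) :
    (T.square f).onE (rangeEdge 0) = T.blue (T.q.onE f) := rfl

theorem square_onE_sourceEdge_zero (f : T.F.E) :
    (T.square f).onE (sourceEdge 0) = T.red (T.F.s f) := rfl

theorem square_onE_rangeEdge_one (f : T.F.E) :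
    (T.square f).onE (rangeEdge 1) = T.red (T.F.r f) := rfl

theorem square_onE_sourceEdge_one (f : T.F.E) :
    (T.square f).onE (sourceEdge 1) = T.blue (T.p.onE f) := rfl

/-- The word of a list of edges of the first colour followed by one of the second colour. -/
def word (x : List T.E.E × List T.F.V) : List T.graph.E := x.1.map T.blue ++ x.2.map T.red

theorem word_injective : Function.Injective T.word := by
  rintro ⟨α, β⟩ ⟨α', β'⟩ h
  have hb : ∀ x : List T.E.E × List T.F.V, List.filterMap Sum.getLeft?
      (x.1.map Sum.inl ++ x.2.map Sum.inr : List (T.E.E ⊕ T.F.V)) = x.1 := fun x => by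
    simp [List.filterMap_append, List.filterMap_map, Function.comp_def]
  have hr : ∀ x : List T.E.E × List T.F.V, List.filterMap Sum.getRight?
      (x.1.map Sum.inl ++ x.2.map Sum.inr : List (T.E.E ⊕ T.F.V)) = x.2 := fun x => by
    simp [List.filterMap_append, List.filterMap_map, Function.comp_def]
  exact Prod.ext ((hb _).symm.trans ((congrArg _ h).trans (hb _)))
    ((hr _).symm.trans ((congrArg _ h).trans (hr _)))

theorem map_color_word (x : List T.E.E × List T.F.V) :
    (T.word x).map T.graph.c = List.replicate x.1.length 0 ++ List.replicate x.2.length 1 := by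
  simp [word, Function.comp_def, c_blue, c_red]

theorem exists_eq_word {m n : ℕ} {l : List T.graph.E}
    (h : l.map T.graph.c = List.replicate m 0 ++ List.replicate n 1) : ∃ x, l = T.word x := by
  obtain ⟨l₁, l₂, rfl, h1, h2⟩ := List.map_eq_append_iff.1 h
  have hb : l₁ ∈ Set.range (List.map T.blue) := by
    rw [Set.range_list_map]
    intro e he
    obtain ⟨a, rfl⟩ := T.eq_blue_of_color (List.eq_of_mem_replicate (h1 ▸ List.mem_map_of_mem he))
    exact ⟨a, rfl⟩
  have hr : l₂ ∈ Set.range (List.map T.red) := by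
    rw [Set.range_list_map]
    intro e he
    obtain ⟨b, rfl⟩ := T.eq_red_of_color (List.eq_of_mem_replicate (h2 ▸ List.mem_map_of_mem he))
    exact ⟨b, rfl⟩
  obtain ⟨α, rfl⟩ := hb
  obtain ⟨β, rfl⟩ := hr
  exact ⟨(α, β), rfl⟩

theorem sum_gen_replicate (m n : ℕ) :
    ((List.replicate m (0 : Fin 2) ++ List.replicate n 1).map gen).sum = ![m, n] := by
  funext i
  fin_cases i <;> simp [gen]

open Classical in
/-- Slide an edge of the second colour past one of the first colour: `(r(f), p(f))` goes to
`(q(f), s(f))`. -/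
noncomputable def slideEdge (b : T.F.V) (a : T.E.E) : T.E.E × T.F.V :=
  -- The default `(a, b)` makes the exchange total, so that associativity holds for all lists; on
  -- paths it is never used, since lifting for `p` supplies an `f`.
  if h : ∃ f, T.F.r f = b ∧ T.p.onE f = a then (T.q.onE h.choose, T.F.s h.choose) else (a, b)

variable {T}

theorem slideEdge_eq (hp : T.p.UniqueRPathLifting) (f : T.F.E) :
    T.slideEdge (T.F.r f) (T.p.onE f) = (T.q.onE f, T.F.s f) := by
  have h : ∃ g, T.F.r g = T.F.r f ∧ T.p.onE g = T.p.onE f := ⟨f, rfl, rfl⟩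
  have : h.choose = f :=
    (hp (T.p.onE f) (T.F.r f) (T.p.map_r f)).unique h.choose_spec ⟨rfl, rfl⟩
  rw [slideEdge, dif_pos h, this]

/-- A property of words that is preserved by sliding single edges inside a word is preserved by
multiplication of pairs of lists. -/
def SwapInvariant (P : List T.graph.E → Prop) : Prop :=
  ∀ l b a l', P (l ++ T.red b :: T.blue a :: l') →
    P (l ++ T.blue (T.slideEdge b a).1 :: T.red (T.slideEdge b a).2 :: l')

theorem SwapInvariant.slideOne {P : List T.graph.E → Prop} (hP : SwapInvariant P) {b : T.F.V}
    {α : List T.E.E} {l l' : List T.graph.E} (h : P (l ++ T.red b :: (α.map T.blue ++ l'))) :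
    P (l ++ ((slideOne T.slideEdge b α).1.map T.blue ++
      T.red (slideOne T.slideEdge b α).2 :: l')) := by
  induction α generalizing b l with
  | nil => exact h
  | cons a α ih =>
    have := ih (l := l ++ [T.blue (T.slideEdge b a).1]) (b := (T.slideEdge b a).2)
      (by simpa using hP _ _ _ _ h)
    simpa [_root_.slideOne] using this

theorem SwapInvariant.slide {P : List T.graph.E → Prop} (hP : SwapInvariant P) {β : List T.F.V}
    {α : List T.E.E} {l l' : List T.graph.E} (h : P (l ++ (β.map T.red ++ (α.map T.blue ++ l')))) :
    P (l ++ (T.word (slide T.slideEdge β α) ++ l')) := by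
  induction β generalizing l with
  | nil => simpa [word, _root_.slide] using h
  | cons b β ih =>
    have h1 := ih (l := l ++ [T.red b]) (by simpa using h)
    have h2 := hP.slideOne (b := b) (α := (_root_.slide T.slideEdge β α).1) (l := l)
      (l' := (_root_.slide T.slideEdge β α).2.map T.red ++ l') (by simpa [word] using h1)
    simpa [word, _root_.slide] using h2

/-- Applied to two properties: being a path between given vertices, and labelling a given morphism.
-/
theorem SwapInvariant.slideMul {P : List T.graph.E → Prop} (hP : SwapInvariant P)
    {x y : List T.E.E × List T.F.V} (h : P (T.word x ++ T.word y)) :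
    P (T.word (slideMul T.slideEdge x y)) := by
  have := hP.slide (l := x.1.map T.blue) (β := x.2) (α := y.1) (l' := y.2.map T.red)
    (by simpa [word] using h)
  simpa [word, _root_.slideMul] using this

theorem exists_of_isPath_red_blue (hp : T.p.UniqueRPathLifting) {b : T.F.V} {a : T.E.E}
    {l : List T.graph.E} {y x : T.graph.V} (h : T.graph.IsPath y (T.red b :: T.blue a :: l) x) :
    ∃ f, T.F.r f = b ∧ T.p.onE f = a :=
  (hp a b h.2.1).exists

theorem swapInvariant_isPath (hp : T.p.UniqueRPathLifting) (y x : T.graph.V) :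
    SwapInvariant (T := T) fun l => T.graph.IsPath y l x := by
  intro l b a l' h
  obtain ⟨z, h1, h2⟩ := ColGraph.isPath_append.1 h
  obtain ⟨f, rfl, rfl⟩ := exists_of_isPath_red_blue hp h2
  obtain ⟨h3, h4, h5⟩ := h2
  refine ColGraph.isPath_append.2 ⟨z, h1, ?_⟩
  rw [slideEdge_eq hp]
  refine ⟨?_, ?_, ?_⟩
  · rw [← h3, r_blue, r_red, T.q.map_r]
  · rw [r_red, s_blue, T.q.map_s]
  · rw [s_red, ← T.p.map_s]
    exact h5

/-- Runs the slide backwards: `b` moves left through `α`, and each exchange is provided by `s`-path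
lifting for `q`. -/
theorem exists_slideOne_eq (hp : T.p.UniqueRPathLifting) (hq : T.q.UniqueSPathLifting)
    {α : List T.E.E} {b : T.F.V} {y x : T.graph.V} {l : List T.graph.E}
    (h : T.graph.IsPath y (α.map T.blue ++ T.red b :: l) x) :
    ∃ b' α', slideOne T.slideEdge b' α' = (α, b) ∧
      T.graph.IsPath y (T.red b' :: (α'.map T.blue ++ l)) x := by
  induction α generalizing y with
  | nil => exact ⟨b, [], rfl, h⟩
  | cons a α ih =>
    obtain ⟨b', α', h1, h2, h3⟩ := ih h.2
    obtain ⟨f, ⟨rfl, rfl⟩, -⟩ := hq a b' h2.symm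
    refine ⟨T.F.r f, T.p.onE f :: α', ?_, ?_, ?_, ?_⟩
    · rw [slideOne, slideEdge_eq hp, h1]
    · rw [← h.1, r_red]
      exact (T.q.map_r f).symm
    · exact T.p.map_r f
    · rw [s_red, ← T.p.map_s] at h3
      exact h3

theorem exists_slide_eq (hp : T.p.UniqueRPathLifting) (hq : T.q.UniqueSPathLifting)
    {α : List T.E.E} {β : List T.F.V} {y x : T.graph.V} (h : T.graph.IsPath y (T.word (α, β)) x) :
    ∃ β' α', slide T.slideEdge β' α' = (α, β) ∧
      T.graph.IsPath y (β'.map T.red ++ α'.map T.blue) x := by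
  induction β generalizing α y with
  | nil => exact ⟨[], α, rfl, by simpa [word] using h⟩
  | cons b β ih =>
    obtain ⟨b', α', h1, h2, h3⟩ := exists_slideOne_eq hp hq h
    obtain ⟨β'', α'', h4, h5⟩ := ih h3
    exact ⟨b' :: β'', α'', by rw [slide, h4, h1], h2, h5⟩

theorem slideEdge_inj (hp : T.p.UniqueRPathLifting) (hq : T.q.UniqueSPathLifting)
    {a a' : T.E.E} {b b' : T.F.V} (h : T.E.r a = T.p.onV b) (h' : T.E.r a' = T.p.onV b')
    (he : T.slideEdge b a = T.slideEdge b' a') : b = b' ∧ a = a' := by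
  obtain ⟨f, ⟨rfl, rfl⟩, -⟩ := hp a b h
  obtain ⟨g, ⟨rfl, rfl⟩, -⟩ := hp a' b' h'
  rw [slideEdge_eq hp, slideEdge_eq hp, Prod.mk.injEq] at he
  obtain rfl : f = g :=
    (hq (T.q.onE f) (T.F.s f) (T.q.map_s f)).unique ⟨rfl, rfl⟩ ⟨he.2.symm, he.1.symm⟩
  exact ⟨rfl, rfl⟩

/-- The paths only guarantee that each exchange takes place in a genuine square; their endpoints and
tails are irrelevant and may differ on the two sides. -/
theorem slideOne_inj (hp : T.p.UniqueRPathLifting) (hq : T.q.UniqueSPathLifting)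
    {α α' : List T.E.E} {b b' : T.F.V} {y y' x x' : T.graph.V} {l l' : List T.graph.E}
    (h : T.graph.IsPath y (T.red b :: (α.map T.blue ++ l)) x)
    (h' : T.graph.IsPath y' (T.red b' :: (α'.map T.blue ++ l')) x')
    (he : slideOne T.slideEdge b α = slideOne T.slideEdge b' α') : b = b' ∧ α = α' := by
  induction α generalizing α' b b' y y' with
  | nil =>
    obtain _ | ⟨a', α'⟩ := α'
    · exact ⟨(Prod.mk.inj he).2, rfl⟩
    · simp [slideOne] at he
  | cons a α ih =>
    obtain _ | ⟨a', α'⟩ := α'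
    · simp [slideOne] at he
    -- After the first exchange the remaining word is again a path headed by a red letter, as the
    -- induction hypothesis needs.
    have k := swapInvariant_isPath hp y x [] b a _ h
    have k' := swapInvariant_isPath hp y' x' [] b' a' _ h'
    simp only [slideOne, Prod.mk.injEq, List.cons.injEq] at he
    obtain ⟨hb, rfl⟩ := ih k.2 k'.2 (Prod.ext he.1.2 he.2)
    obtain ⟨rfl, rfl⟩ := slideEdge_inj hp hq h.2.1 h'.2.1 (Prod.ext he.1.1 hb)
    exact ⟨rfl, rfl⟩

theorem slide_inj (hp : T.p.UniqueRPathLifting) (hq : T.q.UniqueSPathLifting)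
    {α α' : List T.E.E} {β β' : List T.F.V} {y y' x x' : T.graph.V}
    (h : T.graph.IsPath y (β.map T.red ++ α.map T.blue) x)
    (h' : T.graph.IsPath y' (β'.map T.red ++ α'.map T.blue) x')
    (he : slide T.slideEdge β α = slide T.slideEdge β' α') : β = β' ∧ α = α' := by
  induction β generalizing β' y y' with
  | nil =>
    obtain _ | ⟨b', β'⟩ := β'
    · exact ⟨rfl, (Prod.mk.inj he).1⟩
    · simp [slide] at he
  | cons b β ih =>
    obtain _ | ⟨b', β'⟩ := β'
    · simp [slide] at he
    simp only [slide, Prod.mk.injEq, List.cons.injEq] at he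
    have k := (swapInvariant_isPath hp y x).slide (l := [T.red b]) (β := β) (α := α) (l' := [])
      (by simpa using h)
    have k' := (swapInvariant_isPath hp y' x').slide (l := [T.red b']) (β := β') (α := α')
      (l' := []) (by simpa using h')
    simp only [word, List.append_assoc] at k k'
    obtain ⟨rfl, h1⟩ := slideOne_inj hp hq k k' (Prod.ext he.1 he.2.1)
    obtain ⟨rfl, rfl⟩ := ih h.2 h'.2 (Prod.ext h1 he.2.2)
    exact ⟨rfl, rfl⟩

end

/-! ### The `2`-graph of a textile system -/

/-- The objects of the `2`-graph of a textile system. -/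
structure PathObj (T : TextileSystem.{u}) (hp : T.p.UniqueRPathLifting) : Type u where
  vertex : T.graph.V

variable {T : TextileSystem.{u}} {hp : T.p.UniqueRPathLifting}

/-- The category of paths of `T.graph` in normal form. -/
noncomputable instance : Category.{u} (PathObj T hp) where
  Hom X Y := {x : List T.E.E × List T.F.V // T.graph.IsPath Y.vertex (T.word x) X.vertex}
  id _ := ⟨([], []), rfl⟩
  comp {_ _ _} f g := ⟨slideMul T.slideEdge g.1 f.1,
    (swapInvariant_isPath hp _ _).slideMul
      (ColGraph.isPath_append.2 ⟨_, g.2, f.2⟩)⟩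
  id_comp _ := Subtype.ext (slideMul_one _ _)
  comp_id _ := Subtype.ext (one_slideMul _ _)
  assoc _ _ _ := Subtype.ext (slideMul_assoc _ _ _ _).symm

theorem comp_val {X Y Z : PathObj T hp} (f : X ⟶ Y) (g : Y ⟶ Z) :
    (f ≫ g).1 = slideMul T.slideEdge g.1 f.1 := rfl

/-- The degree of a pair of lists. -/
def pairDeg (x : List T.E.E × List T.F.V) : Fin 2 → ℕ := ![x.1.length, x.2.length]

theorem pairDeg_eq_iff {x : List T.E.E × List T.F.V} {m : Fin 2 → ℕ} :
    pairDeg x = m ↔ x.1.length = m 0 ∧ x.2.length = m 1 := by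
  simp [pairDeg, funext_iff, Fin.forall_fin_two]

theorem pairDeg_slideMul (x y : List T.E.E × List T.F.V) :
    pairDeg (slideMul T.slideEdge x y) = pairDeg x + pairDeg y := by
  rw [pairDeg_eq_iff]
  simp [pairDeg, slideMul, length_slide_fst, length_slide_snd]

theorem countable_mor [Countable T.E.V] [Countable T.E.E] [Countable T.F.V] :
    Countable (Σ X Y : PathObj T hp, X ⟶ Y) := by
  have : Countable T.graph.V := ‹Countable T.E.V›
  have hi : Function.Injective fun x : Σ X Y : PathObj T hp, X ⟶ Y =>
      (x.1.vertex, x.2.1.vertex, x.2.2.1) := by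
    rintro ⟨⟨X⟩, ⟨Y⟩, f, hf⟩ ⟨⟨X'⟩, ⟨Y'⟩, f', hf'⟩ h
    simp only [Prod.mk.injEq] at h
    obtain ⟨rfl, rfl, h⟩ := h
    obtain rfl : f = f' := h
    rfl
  exact hi.countable

theorem exists_factorisation (hq : T.q.UniqueSPathLifting) {X Y : PathObj T hp} (f : X ⟶ Y)
    (m n : Fin 2 → ℕ) (h : pairDeg f.1 = m + n) :
    ∃! t : Σ Z : PathObj T hp, (Z ⟶ Y) × (X ⟶ Z),
      pairDeg t.2.1.1 = m ∧ pairDeg t.2.2.1 = n ∧ t.2.2 ≫ t.2.1 = f := by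
  obtain ⟨⟨α, β⟩, hf⟩ := f
  obtain ⟨h0, h1⟩ := pairDeg_eq_iff.1 h
  simp only [Pi.add_apply] at h0 h1
  -- The left factor must begin with the first `m 0` blue letters and contribute the first `m 1` red
  -- ones. Sliding the middle word `α₂ β₁` back to `β' α'` turns `α₁ α₂ β₁ β₂` into the product of
  -- `α₁ β'` and `α' β₂`.
  obtain ⟨α₁, α₂, rfl, hα⟩ : ∃ α₁ α₂, α = α₁ ++ α₂ ∧ α₁.length = m 0 :=
    ⟨α.take (m 0), α.drop (m 0), by simp, by simp; omega⟩
  obtain ⟨β₁, β₂, rfl, hβ⟩ : ∃ β₁ β₂, β = β₁ ++ β₂ ∧ β₁.length = m 1 :=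
    ⟨β.take (m 1), β.drop (m 1), by simp, by simp; omega⟩
  simp only [List.length_append] at h0 h1
  have hword : T.word (α₁ ++ α₂, β₁ ++ β₂) =
      α₁.map T.blue ++ (T.word (α₂, β₁) ++ β₂.map T.red) := by simp [word]
  have hf' := hf
  rw [hword, ColGraph.isPath_append] at hf'
  obtain ⟨y, hy, hf'⟩ := hf'
  obtain ⟨x, hx, hf'⟩ := ColGraph.isPath_append.1 hf'
  obtain ⟨β', α', he, hpath⟩ := exists_slide_eq hp hq hx
  obtain ⟨z, hz, hz'⟩ := ColGraph.isPath_append.1 hpath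
  have hlα : α'.length = α₂.length := by rw [← length_slide_fst T.slideEdge β' α', he]
  have hlβ : β'.length = β₁.length := by rw [← length_slide_snd T.slideEdge β' α', he]
  refine ⟨⟨⟨z⟩, ⟨(α₁, β'), ColGraph.isPath_append.2 ⟨y, hy, hz⟩⟩,
    ⟨(α', β₂), ColGraph.isPath_append.2 ⟨x, hz', hf'⟩⟩⟩, ⟨?_, ?_, ?_⟩, ?_⟩
  · exact pairDeg_eq_iff.2 ⟨hα, hlβ.trans hβ⟩
  · refine pairDeg_eq_iff.2 ⟨?_, ?_⟩
    · dsimp only; omega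
    · dsimp only; omega
  · refine Subtype.ext ?_
    rw [comp_val]
    dsimp only [slideMul]
    rw [he]
  · rintro ⟨⟨z'⟩, ⟨⟨a, b⟩, hμ⟩, ⟨⟨a', b'⟩, hν⟩⟩ ⟨k1, k2, k3⟩
    obtain ⟨k4, k5⟩ := pairDeg_eq_iff.1 k1
    have k6 := congrArg Subtype.val k3
    rw [comp_val] at k6
    dsimp only [slideMul] at k4 k5 k6
    rw [Prod.mk.injEq] at k6
    -- Sliding preserves lengths, so a competing factorisation has the same outer parts `α₁`, `β₂`,
    -- and its inner parts slide to the same pair `(α₂, β₁)`.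
    obtain ⟨rfl, k7⟩ := List.append_inj k6.1 (k4.trans hα.symm)
    obtain ⟨k8, rfl⟩ := List.append_inj k6.2 (by rw [length_slide_snd, k5, hβ])
    obtain ⟨w, -, hw⟩ := ColGraph.isPath_append.1 hμ
    obtain ⟨w', hw', -⟩ := ColGraph.isPath_append.1 hν
    obtain ⟨rfl, rfl⟩ := slide_inj hp hq (ColGraph.isPath_append.2 ⟨_, hw, hw'⟩) hpath
      (by rw [he]; exact Prod.ext k7 k8)
    obtain rfl : z' = z := hμ.source_unique (ColGraph.isPath_append.2 ⟨y, hy, hz⟩)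
    rfl

/-- The `2`-graph of a textile system with unique path lifting. -/
noncomputable def kGraph (T : TextileSystem.{u}) [Countable T.E.V] [Countable T.E.E]
    [Countable T.F.V] (hp : T.p.UniqueRPathLifting) (hq : T.q.UniqueSPathLifting) :
    KGraph.{u, u} 2 where
  Obj := PathObj T hp
  countable_mor := countable_mor
  deg f := pairDeg f.1
  deg_id _ := pairDeg_eq_iff.2 ⟨rfl, rfl⟩
  deg_comp _ _ := pairDeg_slideMul _ _
  factorisation := exists_factorisation hq

end TextileSystem

namespace TextileSystem

variable {T : TextileSystem.{u}}

/-! ### The `2`-graph of `T` presents `T` -/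

/-- The pair of lists given by an edge of `T.graph`. -/
def edgePair : T.graph.E → List T.E.E × List T.F.V :=
  Sum.elim (fun a => ([a], [])) fun b => ([], [b])

theorem word_edgePair (e : T.graph.E) : T.word (edgePair e) = [e] := by
  obtain a | b := e <;> rfl

theorem pairDeg_edgePair (e : T.graph.E) : pairDeg (edgePair e) = gen (T.graph.c e) := by
  obtain a | b := e
  · exact pairDeg_eq_iff.2 ⟨rfl, rfl⟩
  · exact pairDeg_eq_iff.2 ⟨rfl, rfl⟩

section

variable [Countable T.E.V] [Countable T.E.E] [Countable T.F.V] {hp : T.p.UniqueRPathLifting}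
  {hq : T.q.UniqueSPathLifting}

/-- The vertices are matched by equations because the corners of a square agree only through the
morphism laws of `p` and `q`. -/
theorem isComp_kGraph {x y z : (T.kGraph hp hq).Mor} (h1 : y.1 = z.2.1) (h2 : x.1 = z.1)
    (h3 : x.2.1 = y.2.1) (h : x.2.2.1 = slideMul T.slideEdge y.2.2.1 z.2.2.1) :
    KGraph.IsComp y z x := by
  obtain ⟨X, Y, x⟩ := x
  obtain ⟨Y₁, Y₂, y⟩ := y
  obtain ⟨Z₁, Z₂, z⟩ := z
  dsimp only at h1 h2 h3
  subst h1 h2 h3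
  obtain rfl : x = z ≫ y := Subtype.ext h
  exact KGraph.IsComp.mk _ _

variable (T hp hq) in
/-- The isomorphism of `T.graph` with the skeleton of the `2`-graph of `T`. -/
noncomputable def toSkeleton : ColGraph.Hom T.graph (T.kGraph hp hq).skeleton where
  onV x := (⟨x⟩ : PathObj T hp)
  onE e := ⟨T.graph.c e, ⟨(⟨T.graph.s e⟩ : PathObj T hp), (⟨T.graph.r e⟩ : PathObj T hp),
    edgePair e, by rw [word_edgePair]; exact ⟨rfl, rfl⟩⟩, pairDeg_edgePair e⟩
  map_r _ := rfl
  map_s _ := rfl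
  map_c _ := rfl

theorem toSkeleton_isIso : (toSkeleton T hp hq).IsIso := by
  refine ⟨⟨fun x y h => congrArg PathObj.vertex h, fun x => ⟨x.vertex, rfl⟩⟩,
    fun e e' h => ?_, ?_⟩
  · have h' : edgePair e = edgePair e' :=
      congrArg (fun a : (T.kGraph hp hq).skeleton.E => a.2.1.2.2.1) h
    have := congrArg T.word h'
    rw [word_edgePair, word_edgePair, List.cons.injEq] at this
    exact this.1
  · rintro ⟨i, ⟨⟨X⟩, ⟨Y⟩, ⟨x, hx⟩⟩, h⟩
    obtain ⟨e, rfl, rfl⟩ : ∃ e, x = edgePair e ∧ i = T.graph.c e := by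
      obtain ⟨α, β⟩ := x
      obtain ⟨h0, h1⟩ := pairDeg_eq_iff.1 h
      fin_cases i
      · obtain ⟨a, rfl⟩ := List.length_eq_one_iff.1 h0
        obtain rfl := List.length_eq_zero_iff.1 h1
        exact ⟨T.blue a, rfl, rfl⟩
      · obtain rfl := List.length_eq_zero_iff.1 h0
        obtain ⟨b, rfl⟩ := List.length_eq_one_iff.1 h1
        exact ⟨T.red b, rfl, rfl⟩
    have hx' := hx
    rw [word_edgePair] at hx'
    obtain ⟨rfl, rfl⟩ := hx'
    exact ⟨e, rfl⟩

variable (T hp hq) in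
/-- The morphism of the `2`-graph of `T` that is the diagonal of the square of `f`. -/
noncomputable def diagonal (f : T.F.E) : (T.kGraph hp hq).Mor :=
  ⟨(⟨T.p.onV (T.F.s f)⟩ : PathObj T hp), (⟨T.E.r (T.q.onE f)⟩ : PathObj T hp),
    ([T.q.onE f], [T.F.s f]), rfl, (T.q.map_s f).symm, rfl⟩

/-- One side of the square is already in normal form; the other reaches it by a single exchange. -/
theorem isComp_diagonal (f : T.F.E) (i : Fin 2) :
    KGraph.IsComp ((toSkeleton T hp hq).onE ((T.square f).onE (rangeEdge i))).2.1
      ((toSkeleton T hp hq).onE ((T.square f).onE (sourceEdge i))).2.1 (diagonal T hp hq f) := by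
  fin_cases i
  · refine isComp_kGraph ?_ rfl rfl rfl
    exact congrArg (PathObj.mk (hp := hp)) (T.q.map_s f)
  · refine isComp_kGraph ?_ ?_ ?_ ?_
    · exact congrArg (PathObj.mk (hp := hp)) (T.p.map_r f).symm
    · exact congrArg (PathObj.mk (hp := hp)) (T.p.map_s f).symm
    · exact congrArg (PathObj.mk (hp := hp)) (T.q.map_r f)
    · change ([T.q.onE f], [T.F.s f]) = (slideMul T.slideEdge ([], [T.F.r f]) ([T.p.onE f], []))
      simp [slideMul, slide_singleton, slideEdge_eq hp]

theorem presents_kGraph : T.Presents (T.kGraph hp hq) := by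
  refine SquareIsomorphic.symm ⟨toSkeleton T hp hq, toSkeleton_isIso, ?_⟩
  have hmem : ∀ f, ((toSkeleton T hp hq).comp (T.square f)) ∈ (T.kGraph hp hq).squares :=
    fun f => KGraph.mem_squares_iff.2 ⟨_, isComp_diagonal f⟩
  refine Set.Subset.antisymm ?_ ?_
  · rintro _ ⟨_, ⟨f, rfl⟩, rfl⟩
    exact hmem f
  · rintro _ ⟨x, h, rfl⟩
    obtain ⟨⟨X⟩, ⟨Y⟩, ⟨⟨α, β⟩, hx⟩⟩ := x
    obtain ⟨h0, h1⟩ := pairDeg_eq_iff.1 h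
    obtain ⟨a, rfl⟩ := List.length_eq_one_iff.1 h0
    obtain ⟨b, rfl⟩ := List.length_eq_one_iff.1 h1
    have hx' := hx
    obtain ⟨rfl, h3, rfl⟩ := hx'
    -- A morphism of degree `e₁ + e₂` is a blue-red path `a b`, and `s`-path lifting for `q` finds
    -- the square that it is the diagonal of.
    obtain ⟨f, ⟨rfl, rfl⟩, -⟩ := hq a b h3.symm
    refine ⟨T.square f, ⟨f, rfl⟩, ?_⟩
    exact (KGraph.eq_pathHom (isComp_diagonal (hp := hp) (hq := hq) f)).choose_spec

end

/-! ### `2`-graphs that present `T` -/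

section

variable {Λ : KGraph.{v, w} 2} {φ : ColGraph.Hom Λ.skeleton T.graph}

/-- The words along the two sides of the square of `f` label the same morphism. -/
theorem exists_labels_square
    (hC : (fun ψ : Λ.skeleton.Square => φ.comp ψ) '' Λ.squares = T.squares) (f : T.F.E) :
    ∃ x : Λ.Mor, KGraph.Labels φ.onE [T.blue (T.q.onE f), T.red (T.F.s f)] x.2.2 ∧
      KGraph.Labels φ.onE [T.red (T.F.r f), T.blue (T.p.onE f)] x.2.2 := by
  have hf : T.square f ∈ T.squares := ⟨f, rfl⟩
  rw [← hC] at hf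
  obtain ⟨ψ, hψ, he⟩ := hf
  obtain ⟨x, hx⟩ := KGraph.mem_squares_iff.1 hψ
  refine ⟨x, ?_, ?_⟩
  · rw [← square_onE_rangeEdge_zero, ← square_onE_sourceEdge_zero, ← he]
    exact (hx 0).labels
  · rw [← square_onE_rangeEdge_one, ← square_onE_sourceEdge_one, ← he]
    exact (hx 1).labels

theorem exists_square_of_deg_eq
    (hC : (fun ψ : Λ.skeleton.Square => φ.comp ψ) '' Λ.squares = T.squares) {X Y : Λ.Obj}
    {x : X ⟶ Y} (h : Λ.deg x = gen 0 + gen 1) :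
    ∃ f, KGraph.Labels φ.onE [T.blue (T.q.onE f), T.red (T.F.s f)] x ∧
      KGraph.Labels φ.onE [T.red (T.F.r f), T.blue (T.p.onE f)] x := by
  have hψ : φ.comp (KGraph.pathHom ⟨X, Y, x⟩ _ h) ∈ T.squares := by
    rw [← hC]
    exact ⟨_, ⟨_, h, rfl⟩, rfl⟩
  obtain ⟨f, he⟩ := hψ
  have hx := KGraph.isComp_pathHom (x := ⟨X, Y, x⟩) h
  refine ⟨f, ?_, ?_⟩
  · rw [← square_onE_rangeEdge_zero, ← square_onE_sourceEdge_zero, he]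
    exact (hx 0).labels
  · rw [← square_onE_rangeEdge_one, ← square_onE_sourceEdge_one, he]
    exact (hx 1).labels

/-- The first letter fixes the range. The empty word is excluded because it labels every identity.
-/
theorem eq_of_labels (hφ : φ.IsIso) {l : List T.graph.E} {x y : Λ.Mor}
    (hx : KGraph.Labels φ.onE l x.2.2) (hy : KGraph.Labels φ.onE l y.2.2) (hl : l ≠ []) : x = y := by
  obtain ⟨X, Y, x⟩ := x
  obtain ⟨X', Y', y⟩ := y
  have h1 := hx.isPath
  have h2 := hy.isPath
  obtain _ | ⟨e, l⟩ := l
  · exact absurd rfl hl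
  obtain rfl : Y = Y' := hφ.1.1 (h1.1.symm.trans h2.1)
  have := hx.unique hφ.2.1 hy
  rw [Sigma.mk.injEq] at this
  obtain ⟨rfl, h⟩ := this
  obtain rfl := eq_of_heq h
  rfl

theorem word_eq_of_labels {l l' : List T.graph.E} {X Y : Λ.Obj} {x : X ⟶ Y}
    (h : KGraph.Labels φ.onE l x) (h' : KGraph.Labels φ.onE l' x)
    (hl : l.map T.graph.c = l'.map T.graph.c) : l = l' :=
  h.word_unique φ.map_c h' hl

theorem eq_of_labels_red_blue {X Y : Λ.Obj} {x : X ⟶ Y} {b b' : T.F.V}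
    {a a' : T.E.E} (h : KGraph.Labels φ.onE [T.red b, T.blue a] x)
    (h' : KGraph.Labels φ.onE [T.red b', T.blue a'] x) : b = b' ∧ a = a' := by
  have := word_eq_of_labels h h' rfl
  simpa [T.red_injective.eq_iff, T.blue_injective.eq_iff] using this

theorem eq_of_labels_blue_red {X Y : Λ.Obj} {x : X ⟶ Y} {b b' : T.F.V}
    {a a' : T.E.E} (h : KGraph.Labels φ.onE [T.blue a, T.red b] x)
    (h' : KGraph.Labels φ.onE [T.blue a', T.red b'] x) : a = a' ∧ b = b' := by
  have := word_eq_of_labels h h' rfl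
  simpa [T.red_injective.eq_iff, T.blue_injective.eq_iff] using this

theorem exists_labels_two (hφ : φ.IsIso) {e e' : T.graph.E} (h : T.graph.s e = T.graph.r e') :
    ∃ x : Λ.Mor, KGraph.Labels φ.onE [e, e'] x.2.2 := by
  obtain ⟨Y, hY⟩ := hφ.1.2 (T.graph.r e)
  obtain ⟨X, hX⟩ := hφ.1.2 (T.graph.s e')
  obtain ⟨x, hx⟩ := KGraph.exists_labels_of_isPath φ hφ (l := [e, e']) (X := X) (Y := Y)
    ⟨hY.symm, h.symm, hX.symm⟩
  exact ⟨⟨X, Y, x⟩, hx⟩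

/-- A common diagonal forces all four edges to agree; the injectivity axiom of a textile system then
identifies `f` and `g`. -/
theorem square_unique {f g : T.F.E} {x : Λ.Mor}
    (hf : KGraph.Labels φ.onE [T.blue (T.q.onE f), T.red (T.F.s f)] x.2.2 ∧
      KGraph.Labels φ.onE [T.red (T.F.r f), T.blue (T.p.onE f)] x.2.2)
    (hg : KGraph.Labels φ.onE [T.blue (T.q.onE g), T.red (T.F.s g)] x.2.2 ∧
      KGraph.Labels φ.onE [T.red (T.F.r g), T.blue (T.p.onE g)] x.2.2) : f = g := by
  obtain ⟨h1, h2⟩ := eq_of_labels_blue_red hf.1 hg.1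
  obtain ⟨h3, h4⟩ := eq_of_labels_red_blue hf.2 hg.2
  exact T.injective (by simp only [h1, h2, h3, h4])

/-! ### Unique path lifting from unique factorisation -/

theorem uniqueRPathLifting_of_isIso (hφ : φ.IsIso)
    (hC : (fun ψ : Λ.skeleton.Square => φ.comp ψ) '' Λ.squares = T.squares) :
    T.p.UniqueRPathLifting := by
  intro e w h
  obtain ⟨x, hx⟩ := exists_labels_two hφ (e := T.red w) (e' := T.blue e) h.symm
  have hd : Λ.deg x.2.2 = gen 0 + gen 1 := by
    rw [hx.deg_eq φ.map_c, add_comm]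
    simp [c_red, c_blue]
  obtain ⟨f, hf⟩ := exists_square_of_deg_eq hC hd
  obtain ⟨rfl, rfl⟩ := eq_of_labels_red_blue hf.2 hx
  refine ⟨f, ⟨rfl, rfl⟩, ?_⟩
  rintro g ⟨hg1, hg2⟩
  obtain ⟨y, hy⟩ := exists_labels_square hC g
  -- Another lift `g` has the same red-blue side, hence the same diagonal.
  obtain rfl : y = x := eq_of_labels hφ hy.2 (by rw [hg1, hg2]; exact hf.2) (by simp)
  exact square_unique hy hf

theorem uniqueSPathLifting_of_isIso (hφ : φ.IsIso)
    (hC : (fun ψ : Λ.skeleton.Square => φ.comp ψ) '' Λ.squares = T.squares) :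
    T.q.UniqueSPathLifting := by
  intro e w h
  obtain ⟨x, hx⟩ := exists_labels_two hφ (e := T.blue e) (e' := T.red w) h
  have hd : Λ.deg x.2.2 = gen 0 + gen 1 := by
    rw [hx.deg_eq φ.map_c]
    simp [c_red, c_blue]
  obtain ⟨f, hf⟩ := exists_square_of_deg_eq hC hd
  obtain ⟨rfl, rfl⟩ := eq_of_labels_blue_red hf.1 hx
  refine ⟨f, ⟨rfl, rfl⟩, ?_⟩
  rintro g ⟨hg1, hg2⟩
  obtain ⟨y, hy⟩ := exists_labels_square hC g
  obtain rfl : y = x := eq_of_labels hφ hy.1 (by rw [hg1, hg2]; exact hf.1) (by simp)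
  exact square_unique hy hf

/-- The two exchanged letters label a middle factor of `x`. It is the diagonal of a square, so the
opposite side of that square labels it too. -/
theorem swapInvariant_labels (hp : T.p.UniqueRPathLifting) (hφ : φ.IsIso)
    (hC : (fun ψ : Λ.skeleton.Square => φ.comp ψ) '' Λ.squares = T.squares) {X Y : Λ.Obj}
    (x : X ⟶ Y) : SwapInvariant (T := T) fun l => KGraph.Labels φ.onE l x := by
  intro l b a l' h
  obtain ⟨Z, μ, ν, rfl, hμ, hν⟩ := KGraph.labels_append.1 h
  obtain ⟨W, ν₁, ν₂, rfl, hν₁, hν₂⟩ := KGraph.labels_append (l := [T.red b, T.blue a]).1 hν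
  obtain ⟨f, rfl, rfl⟩ := exists_of_isPath_red_blue hp hν₁.isPath
  obtain ⟨y, hy1, hy2⟩ := exists_labels_square hC f
  obtain rfl := eq_of_labels (x := y) (y := ⟨W, Z, ν₁⟩) hφ hy2 hν₁ (by simp)
  rw [slideEdge_eq hp]
  exact KGraph.labels_append.2 ⟨Z, μ, _, rfl, hμ,
    KGraph.labels_append (l := [T.blue _, T.red _]).2 ⟨W, ν₁, ν₂, rfl, hy1, hν₂⟩⟩

/-! ### Normal forms in a 2-graph that presents `T` -/

theorem pairDeg_of_labels {x : List T.E.E × List T.F.V} {X Y : Λ.Obj} {f : X ⟶ Y}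
    (h : KGraph.Labels φ.onE (T.word x) f) : pairDeg x = Λ.deg f := by
  rw [h.deg_eq φ.map_c, map_color_word, sum_gen_replicate, pairDeg]

variable (φ) in
theorem exists_labels_word {X Y : Λ.Obj} (f : X ⟶ Y) :
    ∃ x, KGraph.Labels φ.onE (T.word x) f := by
  obtain ⟨l, hl, hf⟩ := KGraph.exists_labels (c := T.graph.c) φ.map_c
    (List.replicate (Λ.deg f 0) 0 ++ List.replicate (Λ.deg f 1) 1) f (by
      rw [sum_gen_replicate]
      funext i
      fin_cases i <;> rfl)
  obtain ⟨x, rfl⟩ := T.exists_eq_word hl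
  exact ⟨x, hf⟩

theorem labels_word_unique {x y : List T.E.E × List T.F.V} {X Y : Λ.Obj} {f : X ⟶ Y}
    (hx : KGraph.Labels φ.onE (T.word x) f) (hy : KGraph.Labels φ.onE (T.word y) f) : x = y := by
  refine T.word_injective (word_eq_of_labels hx hy ?_)
  obtain ⟨h0, h1⟩ := pairDeg_eq_iff.1 ((pairDeg_of_labels hx).trans (pairDeg_of_labels hy).symm)
  rw [map_color_word, map_color_word, h0, h1]
  rfl

theorem nonempty_iso_kGraph [Countable T.E.V] [Countable T.E.E] [Countable T.F.V]
    (hp : T.p.UniqueRPathLifting) (hq : T.q.UniqueSPathLifting) (h : T.Presents Λ) :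
    Nonempty (KGraph.Iso Λ (T.kGraph hp hq)) := by
  obtain ⟨φ, hφ, hC⟩ := h
  choose nf hnf using fun (X Y : Λ.Obj) (f : X ⟶ Y) => exists_labels_word φ f
  let F : Λ.Obj ⥤ PathObj T hp :=
    { obj := fun X => ⟨φ.onV X⟩
      map := fun {X Y} f => ⟨nf X Y f, (hnf X Y f).isPath⟩
      map_id := fun X => Subtype.ext (labels_word_unique (hnf X X (𝟙 X)) (KGraph.labels_id X))
      -- The product of the two normal forms still labels the composite, and a morphism has only one
      -- normal form.
      map_comp := fun {X Y Z} f g => Subtype.ext (labels_word_unique (hnf X Z (f ≫ g))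
        ((swapInvariant_labels hp hφ hC (f ≫ g)).slideMul
          (KGraph.labels_append.2 ⟨Y, g, f, rfl, hnf Y Z g, hnf X Y f⟩))) }
  refine ⟨⟨F, ⟨fun X Y h => hφ.1.1 (congrArg PathObj.vertex h), ?_⟩, fun X Y => ⟨?_, ?_⟩,
    fun f => pairDeg_of_labels (hnf _ _ f)⟩⟩
  · rintro ⟨v⟩
    obtain ⟨X, rfl⟩ := hφ.1.2 v
    exact ⟨X, rfl⟩
  · intro f g h
    have h' : nf X Y f = nf X Y g := congrArg Subtype.val h
    have := (hnf X Y f).unique hφ.2.1 (by rw [h']; exact hnf X Y g)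
    rw [Sigma.mk.injEq] at this
    exact eq_of_heq this.2
  · rintro ⟨x, hx⟩
    obtain ⟨f, hf⟩ := KGraph.exists_labels_of_isPath φ hφ hx
    exact ⟨f, Subtype.ext (labels_word_unique (hnf X Y f) hf)⟩

theorem countable_of_presents (h : T.Presents Λ) :
    Countable T.E.V ∧ Countable T.E.E ∧ Countable T.F.V := by
  obtain ⟨φ, hφ, -⟩ := h
  have := Λ.countable_mor
  have hE : Countable T.graph.E := by
    have : Countable Λ.skeleton.E :=
      inferInstanceAs (Countable (Σ i : Fin 2, {x : Λ.Mor // x.d = gen i}))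
    exact hφ.2.2.countable
  have hV : Countable Λ.skeleton.V := by
    have hi : Function.Injective fun X : Λ.Obj => (⟨X, X, 𝟙 X⟩ : Λ.Mor) :=
      fun X Y h => congrArg Sigma.fst h
    exact hi.countable
  exact ⟨hφ.1.2.countable, T.blue_injective.countable, T.red_injective.countable⟩

end

end TextileSystem

theorem mainTheorem3 (T : TextileSystem.{u}) :
    (Countable T.E.V → Countable T.E.E → Countable T.F.V →
      T.p.UniqueRPathLifting → T.q.UniqueSPathLifting →
      ∃ ΛT : KGraph.{u, u} 2, T.Presents ΛT ∧
        ∀ Λ : KGraph.{v, w} 2, T.Presents Λ → Nonempty (KGraph.Iso Λ ΛT)) ∧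
    (∀ Λ : KGraph.{v, w} 2, T.Presents Λ →
      T.p.UniqueRPathLifting ∧ T.q.UniqueSPathLifting ∧
        ∀ ΛT : KGraph.{u, u} 2, T.Presents ΛT → Nonempty (KGraph.Iso Λ ΛT)) := by
  refine ⟨fun _ _ _ hp hq => ⟨T.kGraph hp hq, TextileSystem.presents_kGraph,
    fun Λ hΛ => TextileSystem.nonempty_iso_kGraph hp hq hΛ⟩, fun Λ hΛ => ?_⟩
  -- Countability is not assumed in the converse; it is inherited from `Λ` and is needed to form the
  -- 2-graph of paths used for comparison.
  obtain ⟨_, _, _⟩ := TextileSystem.countable_of_presents hΛ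
  obtain ⟨φ, hφ, hC⟩ := id hΛ
  have hp := TextileSystem.uniqueRPathLifting_of_isIso hφ hC
  have hq := TextileSystem.uniqueSPathLifting_of_isIso hφ hC
  refine ⟨hp, hq, fun ΛT hT => ?_⟩
  obtain ⟨F⟩ := TextileSystem.nonempty_iso_kGraph hp hq hΛ
  obtain ⟨G⟩ := TextileSystem.nonempty_iso_kGraph hp hq hT
  exact ⟨F.trans G.symm⟩
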